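/- Let $A=\mathrm{diag}(a_1,\dots,a_M)$ and $W$ be real $M\times M$ matrices, $h\in\mathbb R^M$, and consider the piecewise-linear recurrent network (PLRNN) $Z_{t+1}=AZ_t+W\max(Z_t,0)+h$ on $\mathbb R^M$ (maximum taken entrywise). For an activation pattern $\Omega\in\{0,1\}^M$ let $D_\Omega=\mathrm{diag}(\Omega)$, $W_\Omega=A+WD_\Omega$ and $S_\Omega=\{Z: Z_i>0 \text{ if }\Omega_i=1,\ Z_i\le 0\text{ if }\Omega_i=0\}$, so that on $S_\Omega$ the network is the affine map $Z_{t+1}=W_\Omega Z_t+h$. Let $\Delta t>0$, and suppose that $W_\Omega$ is invertible and does not have the eigenvalue $1$. A logarithm of a square matrix $B$ is a matrix $L$ with $e^L=B$; it need not be unique, and it may be complex when $B$ is real. For a logarithm $L$ of $W_\Omega$ put $$\tilde W=\frac1{\Delta t}L,\qquad \tilde h=-\frac1{\Delta t}L\,(I-W_\Omega)^{-1}h .$$ (1) $W_\Omega$ has a complex logarithm. For every logarithm $L$ of $W_\Omega$, the matrix $\tilde W$ is invertible, and the system $\dot\zeta=\tilde W\zeta+\tilde h$ is equivalent to the affine map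 over one time step: for all $t_0\in\mathbb R$ and $Z\in\mathbb R^M$ (in particular for $Z\in S_\Omega$) it has a solution on $[t_0,t_0+\Delta t]$ with $\zeta(t_0)=Z$, and every such solution satisfies $\zeta(t_0+\Delta t)=W_\Omega Z+h$. The logarithm can be chosen such that $\tilde W$ does not have the eigenvalue $1$; and if $e^{\Delta t}$ is not an eigenvalue of $W_\Omega$, then $\tilde W$ does not have the eigenvalue $1$ for any logarithm $L$. Furthermore, if in the complex Jordan form of $W_\Omega$ each $k\times k$ Jordan block with a negative real eigenvalue occurs an even number of times, then $L$ can be chosen real; then $\tilde W$ and $\tilde h$ are real, and the real system $\dot\zeta=\tilde W\zeta+\tilde h$ on $\mathbb R^M$ is equivalent to the affine map in the same sense. (2) If moreover $W_\Omega$ is diagonalizable over $\mathbb C$, then for every logarithm $L$ of $W_\Omega$ the matrix $\tilde W$ is invertible and diagonalizable over $\mathbb C$. -/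

import Mathlib

open Matrix

noncomputable section

namespace PLRNN

/-- One step of the discrete-time network `Z ↦ A Z + W φ(Z) + h`, where `A = diag(a)` and
`φ(Z) = max(Z, 0)` is applied entrywise. -/
def step {M : ℕ} (a : Fin M → ℝ) (W : Matrix (Fin M) (Fin M) ℝ) (h : Fin M → ℝ)
    (Z : Fin M → ℝ) : Fin M → ℝ :=
  diagonal a *ᵥ Z + W *ᵥ (fun i => max (Z i) 0) + h

/-- The sub-region of `ℝ^M` belonging to the activation pattern `Ω`. -/
def region {M : ℕ} (Ω : Fin M → Bool) : Set (Fin M → ℝ) :=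
  {Z | ∀ i, if Ω i then 0 < Z i else Z i ≤ 0}

/-- The matrix `W_Ω = A + W D_Ω` of the affine piece with activation pattern `Ω`, where
`D_Ω` is the diagonal `0/1` matrix given by `Ω`. -/
def pieceMatrix {M : ℕ} (a : Fin M → ℝ) (W : Matrix (Fin M) (Fin M) ℝ) (Ω : Fin M → Bool) :
    Matrix (Fin M) (Fin M) ℝ :=
  diagonal a + W * diagonal (fun i => if Ω i then (1 : ℝ) else 0)

/-- `L` is a logarithm of the square matrix `B`: `exp L = B`. A logarithm is in general not
unique, and a real matrix may have complex logarithms only. -/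
def IsLog {𝕜 : Type*} [RCLike 𝕜] {n : Type*} [Fintype n] [DecidableEq n]
    (L B : Matrix n n 𝕜) : Prop :=
  NormedSpace.exp L = B

/-- The complex matrix with the same entries as the real matrix `B`. -/
def toComplex {m n : Type*} (B : Matrix m n ℝ) : Matrix m n ℂ :=
  B.map (fun x => (x : ℂ))

/-- The complex vector with the same entries as the real vector `v`. -/
def vecToComplex {n : Type*} (v : n → ℝ) : n → ℂ := fun i => (v i : ℂ)

/-- `W̃ = (1/Δt) L`, for a chosen logarithm `L`. -/
def odeMatrix {𝕜 : Type*} [RCLike 𝕜] {M : ℕ} (Δt : ℝ) (L : Matrix (Fin M) (Fin M) 𝕜) :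
    Matrix (Fin M) (Fin M) 𝕜 :=
  (1 / Δt) • L

/-- `h̃ = -(1/Δt) L (I - B)⁻¹ h`, for a chosen logarithm `L` of `B`. -/
def odeBias {𝕜 : Type*} [RCLike 𝕜] {M : ℕ} (Δt : ℝ) (L B : Matrix (Fin M) (Fin M) 𝕜)
    (h : Fin M → 𝕜) : Fin M → 𝕜 :=
  -((1 / Δt) • ((L * (1 - B)⁻¹) *ᵥ h))

/-- The system `ζ' = A ζ + b` reproduces the map `F` over one time step `Δt`: for every real
starting vector `Z` and every starting time `t₀`, the system has a solution `ζ` on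
`[t₀, t₀ + Δt]` with `ζ(t₀) = Z`, and every such solution satisfies `ζ(t₀ + Δt) = F Z`. -/
def ReproducesStep {𝕜 : Type*} [RCLike 𝕜] {M : ℕ} (A : Matrix (Fin M) (Fin M) 𝕜)
    (b : Fin M → 𝕜) (Δt : ℝ) (F : (Fin M → ℝ) → (Fin M → ℝ)) : Prop :=
  ∀ (t₀ : ℝ) (Z : Fin M → ℝ),
    (∃ ζ : ℝ → Fin M → 𝕜,
      IsIntegralCurveOn ζ (fun _ x => A *ᵥ x + b) (Set.Icc t₀ (t₀ + Δt)) ∧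
        ζ t₀ = fun i => (Z i : 𝕜)) ∧
    ∀ ζ : ℝ → Fin M → 𝕜,
      IsIntegralCurveOn ζ (fun _ x => A *ᵥ x + b) (Set.Icc t₀ (t₀ + Δt)) →
        (ζ t₀ = fun i => (Z i : 𝕜)) →
          ζ (t₀ + Δt) = fun i => (F Z i : 𝕜)

/-- The `k × k` Jordan block with eigenvalue `μ` (ones on the superdiagonal). -/
def jordanBlock (k : ℕ) (μ : ℂ) : Matrix (Fin k) (Fin k) ℂ :=
  Matrix.of fun i j => if i = j then μ else if (i : ℕ) + 1 = (j : ℕ) then 1 else 0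

/-- The matrix `B` is similar to the direct sum of the (nonempty) Jordan blocks of sizes
`size i` with eigenvalues `ev i`; that is, these blocks form the Jordan form of `B`. -/
def HasJordanForm {n : Type*} [Fintype n] [DecidableEq n] (B : Matrix n n ℂ) {r : ℕ}
    (size : Fin r → ℕ) (ev : Fin r → ℂ) : Prop :=
  (∀ i, 0 < size i) ∧
    ∃ (P : Matrix n (Σ i, Fin (size i)) ℂ) (Q : Matrix (Σ i, Fin (size i)) n ℂ),
      P * Q = 1 ∧ Q * P = 1 ∧
        B = P * blockDiagonal' (fun i => jordanBlock (size i) (ev i)) * Q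

/-- In the Jordan form of `B`, every `k × k` Jordan block associated with a negative real
eigenvalue occurs an even number of times. -/
def EvenNegativeJordanBlocks {n : Type*} [Fintype n] [DecidableEq n] (B : Matrix n n ℂ) :
    Prop :=
  ∃ (r : ℕ) (size : Fin r → ℕ) (ev : Fin r → ℂ), HasJordanForm B size ev ∧
    ∀ x : ℝ, x < 0 → ∀ k : ℕ, Even (Nat.card {i : Fin r // size i = k ∧ ev i = (x : ℂ)})

/-- `B` is diagonalizable over `ℂ`. -/
def IsDiagonalizable {n : Type*} [Fintype n] [DecidableEq n] (B : Matrix n n ℂ) : Prop :=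
  ∃ (P : Matrix n n ℂ) (d : n → ℂ), IsUnit P ∧ B = P * diagonal d * P⁻¹

end PLRNN

end

/-! The dynamical claim is a change of origin. Since 1 is not an eigenvalue of B = `W_Ω`, the affine
map has the fixed point p = (1 - B)⁻¹h, and h̃ = -W̃p, so the solution through Z is exp((t -
t₀)W̃)(Z - p) + p, which equals B(Z - p) + p = BZ + h after time Δt. Uniqueness holds because the
field is Lipschitz. A kernel vector of L would be fixed by exp L = B, so W̃ is invertible.

Logarithms are built by integration: if 1 + t(B - 1) is invertible for all t in [0, 1], integrating
the logarithmic derivative of this path inside the bicommutant of B gives a logarithm that commutes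
with everything commuting with B. Over ℂ, multiplying B by a suitable scalar removes all real
eigenvalues and makes the segment admissible; a scalar logarithm then corrects the factor. Adding
multiples of 2πi moves the spectrum of L off any prescribed value.

Over ℝ the obstruction is the negative spectrum. Evenly occurring blocks can be paired, which gives
a complex structure R (R² = -1) commuting with the real Jordan matrix C of the negative part. With a
real projection E onto that part, B(1 - 2E) has no eigenvalue in (-∞, 0] and so has a real logarithm
K. Because exp(πR) = -1, the transported πR is a logarithm of 1 - 2E commuting with K, and the sum
of the two is a logarithm of B (`exists_isLog_real_of_intertwiner`).

Diagonalizability passes from B to L because a Jordan chain of length two for L at μ is one for B at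
exp μ. -/

namespace PLRNN

/-! ### The exponential flow, and logarithms along segments of units -/

open scoped Matrix.Norms.Operator in
theorem hasDerivAt_exp_smul_mulVec {𝕜 : Type*} [RCLike 𝕜] {n : Type*} [Fintype n] [DecidableEq n]
    (A : Matrix n n 𝕜) (w : n → 𝕜) (s t : ℝ) :
    HasDerivAt (fun t : ℝ => NormedSpace.exp ((t - s) • A) *ᵥ w)
      (A *ᵥ (NormedSpace.exp ((t - s) • A) *ᵥ w)) t := by
  have h1 : HasDerivAt (fun t : ℝ => NormedSpace.exp ((t - s) • A))
      (A * NormedSpace.exp ((t - s) • A)) t := by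
    have := (hasDerivAt_exp_smul_const' A (t - s)).scomp t ((hasDerivAt_id t).sub_const s)
    simp only [Function.comp_def, one_smul, id_eq] at this
    exact this
  have h2 := ((((Matrix.mulVecBilin ℝ ℝ).flip w :
    Matrix n n 𝕜 →ₗ[ℝ] (n → 𝕜)).toContinuousLinearMap).hasFDerivAt).comp_hasDerivAt t h1
  rw [Matrix.mulVec_mulVec]
  exact h2

/-- If `a` can be joined to `1` by a segment of units in a commutative Banach algebra, then it
has a logarithm. -/
theorem exists_exp_eq_of_segment {A : Type*} [NormedCommRing A] [NormedAlgebra ℝ A]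
    [CompleteSpace A] (a : A)
    (ha : ∀ t ∈ Set.Icc (0 : ℝ) 1, IsUnit (1 + t • (a - 1))) :
    ∃ L : A, NormedSpace.exp L = a := by
  let : NormedAlgebra ℚ A := NormedAlgebra.restrictScalars ℚ ℝ A
  set g : ℝ → A := fun t => 1 + t • (a - 1) with hg
  have hgc : Continuous g := by fun_prop
  have hgd : ∀ t, HasDerivAt g (a - 1) t := fun t => by
    have := ((hasDerivAt_id t).smul_const (a - 1)).const_add 1
    rwa [one_smul] at this
  -- This is g'/g. Its primitive f makes exp(-f) · g constant, so exp (f 1) = g 1 = a.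
  set r : ℝ → A := fun t => (a - 1) * Ring.inverse (g t) with hr
  set U : Set ℝ := {t | IsUnit (g t)} with hU
  have hUo : IsOpen U := Units.isOpen.preimage hgc
  have hrc : ∀ t ∈ U, ContinuousAt r t := by
    rintro t ⟨u, hu⟩
    refine continuousAt_const.mul ?_
    have := NormedRing.inverse_continuousAt u
    rw [hu] at this
    exact ContinuousAt.comp (f := g) (g := Ring.inverse) this hgc.continuousAt
  have hrc' : ContinuousOn r U := fun t ht => (hrc t ht).continuousWithinAt
  set f : ℝ → A := fun t => ∫ s in (0 : ℝ)..t, r s with hf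
  have hfd : ∀ t ∈ Set.Icc (0 : ℝ) 1, HasDerivAt f (r t) t := by
    intro t ht
    refine intervalIntegral.integral_hasDerivAt_right ?_ ?_ (hrc t (ha t ht))
    · refine ContinuousOn.intervalIntegrable ?_
      rw [Set.uIcc_of_le ht.1]
      exact hrc'.mono fun s hs => ha s ⟨hs.1, hs.2.trans ht.2⟩
    · exact hrc'.stronglyMeasurableAtFilter hUo t (ha t ht)
  set F : ℝ → A := fun t => NormedSpace.exp (-f t) * g t with hF
  have hFd : ∀ t ∈ Set.Icc (0 : ℝ) 1, HasDerivAt F 0 t := by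
    intro t ht
    have h1 := (hasFDerivAt_exp (𝕂 := ℝ) (x := -f t)).comp_hasDerivAt t (hfd t ht).neg
    have h2 := h1.mul (hgd t)
    refine h2.congr_deriv ?_
    have hu : Ring.inverse (g t) * g t = 1 := Ring.inverse_mul_cancel _ (ha t ht)
    change NormedSpace.exp (-f t) * -((a - 1) * Ring.inverse (g t)) * g t +
      NormedSpace.exp (-f t) * (a - 1) = 0
    linear_combination (-(NormedSpace.exp (-f t) * (a - 1))) * hu
  have h01 : F 1 = F 0 :=
    constant_of_has_deriv_right_zero (fun t ht => (hFd t ht).continuousAt.continuousWithinAt)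
      (fun t ht => (hFd t (Set.Ico_subset_Icc_self ht)).hasDerivWithinAt) 1 ⟨zero_le_one, le_rfl⟩
  refine ⟨f 1, ?_⟩
  have h3 : NormedSpace.exp (-f 1) * a = 1 := by
    simpa [hF, hf, hg] using h01
  have h4 : NormedSpace.exp (f 1) * NormedSpace.exp (-f 1) = 1 := by
    rw [← NormedSpace.exp_add, add_neg_cancel, NormedSpace.exp_zero]
  calc NormedSpace.exp (f 1) = NormedSpace.exp (f 1) * (NormedSpace.exp (-f 1) * a) := by
        rw [h3, mul_one]
    _ = a := by rw [← mul_assoc, h4, one_mul]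

open scoped Matrix.Norms.Operator in
/-- A matrix joined to `1` by a segment of invertible matrices has a logarithm in its
bicommutant. -/
theorem exists_isLog_of_segment {𝕜 : Type*} [RCLike 𝕜] {n : Type*} [Fintype n] [DecidableEq n]
    (B : Matrix n n 𝕜) (hB : ∀ t ∈ Set.Icc (0 : ℝ) 1, IsUnit (1 + t • (B - 1))) :
    ∃ L : Matrix n n 𝕜, IsLog L B ∧ ∀ X, Commute X B → Commute X L := by
  -- The bicommutant of B is commutative, because B commutes with itself, and closed under inverses,
  -- so the segment consists of units of S as well.
  let S : Subalgebra ℝ (Matrix n n 𝕜) :=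
    Subalgebra.centralizer ℝ (Subalgebra.centralizer ℝ {B} : Set (Matrix n n 𝕜))
  have hS : ∀ {Y}, Y ∈ S ↔ ∀ X, Commute X B → Commute X Y := by
    intro Y
    simp only [S, Subalgebra.mem_centralizer_iff, SetLike.mem_coe, Set.mem_singleton_iff,
      forall_eq]
    exact ⟨fun h X hX => h X hX.symm, fun h X hX => h X hX.symm⟩
  have hBS : B ∈ S := hS.2 fun X hX => hX
  let : NormedCommRing S :=
    { (inferInstance : NormedRing S) with
      mul_comm := fun x y => Subtype.ext <|
        hS.1 y.2 x (hS.1 x.2 B (Commute.refl B)).symm }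
  let : NormedAlgebra ℚ S := NormedAlgebra.restrictScalars ℚ ℝ S
  have : CompleteSpace S :=
    (Submodule.complete_of_finiteDimensional (Subalgebra.toSubmodule S)).completeSpace_coe
  obtain ⟨L, hL⟩ := exists_exp_eq_of_segment (⟨B, hBS⟩ : S) (by
    intro t ht
    obtain ⟨u, hu⟩ := hB t ht
    have hmem : (u : Matrix n n 𝕜) ∈ S := hu ▸ (1 + t • ((⟨B, hBS⟩ : S) - 1)).2
    have hinv : ((u⁻¹ : (Matrix n n 𝕜)ˣ) : Matrix n n 𝕜) ∈ S :=
      hS.2 fun X hX => (hS.1 hmem X hX).units_inv_right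
    refine IsUnit.of_mul_eq_one ⟨_, hinv⟩ (Subtype.ext ?_)
    change (1 + t • (B - 1)) * _ = 1
    rw [← hu, Units.mul_inv])
  refine ⟨L, ?_, hS.1 L.2⟩
  have := NormedSpace.map_exp S.val continuous_subtype_val L
  rw [hL] at this
  exact this.symm

end PLRNN

namespace PLRNN

/-! ### Eigenvectors, and the exponential on short Jordan chains -/

section Field

variable {K : Type*} [Field K] {n : Type*} [Fintype n] [DecidableEq n]

theorem eval_charpoly_ne_zero_iff (A : Matrix n n K) (μ : K) :
    A.charpoly.eval μ ≠ 0 ↔ ∀ v, A *ᵥ v = μ • v → v = 0 := by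
  rw [Matrix.eval_charpoly, Ne, ← Matrix.exists_mulVec_eq_zero_iff]
  push Not
  refine forall_congr' fun v => ?_
  rw [Ne]
  rw [Matrix.sub_mulVec, Matrix.scalar_apply, ← Matrix.smul_one_eq_diagonal, Matrix.smul_mulVec,
    Matrix.one_mulVec, ← not_imp_not, not_not, not_not, sub_eq_zero, eq_comm (a := μ • v)]

theorem isUnit_iff_mulVec (A : Matrix n n K) : IsUnit A ↔ ∀ v, A *ᵥ v = 0 → v = 0 := by
  rw [← Matrix.mulVec_injective_iff_isUnit, ← Matrix.coe_mulVecLin]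
  exact injective_iff_map_eq_zero A.mulVecLin

end Field

section Exp

variable {𝕜 : Type*} [RCLike 𝕜] {n : Type*} [Fintype n] [DecidableEq n]

open scoped Matrix.Norms.Operator in
theorem hasSum_exp (A : Matrix n n 𝕜) :
    HasSum (fun k : ℕ => ((k.factorial : ℝ)⁻¹) • A ^ k) (NormedSpace.exp A) := by
  let : NormedAlgebra ℚ (Matrix n n 𝕜) := NormedAlgebra.restrictScalars ℚ ℝ _
  exact NormedSpace.exp_series_hasSum_exp' (𝕂 := ℝ) A

/-- On such a vector the exponential series stops after the linear term. -/
theorem exp_mulVec_of_mulVec_mulVec_eq_zero {N : Matrix n n 𝕜} {v : n → 𝕜}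
    (hv : N *ᵥ (N *ᵥ v) = 0) : NormedSpace.exp N *ᵥ v = v + N *ᵥ v := by
  have h1 := (hasSum_exp N).map ((Matrix.mulVecBilin ℝ ℝ).flip v : Matrix n n 𝕜 →ₗ[ℝ] (n → 𝕜))
    (by
      change Continuous fun A : Matrix n n 𝕜 => A *ᵥ v
      fun_prop)
  have h2 := hasSum_sum_of_ne_finset_zero (L := SummationFilter.unconditional ℕ) (s := Finset.range 2)
    (f := fun k : ℕ => (((k.factorial : ℝ)⁻¹) • N ^ k) *ᵥ v) (by
      intro k hk
      obtain ⟨j, rfl⟩ : ∃ j, k = j + 2 := ⟨k - 2, by simp at hk; omega⟩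
      rw [Matrix.smul_mulVec, pow_add, ← Matrix.mulVec_mulVec, pow_two, ← Matrix.mulVec_mulVec,
        hv, Matrix.mulVec_zero, smul_zero])
  have h3 := h1.unique h2
  simpa [Finset.sum_range_succ] using h3

theorem exp_smul_one (μ : 𝕜) :
    NormedSpace.exp (μ • (1 : Matrix n n 𝕜)) = NormedSpace.exp μ • (1 : Matrix n n 𝕜) := by
  rw [Matrix.smul_one_eq_diagonal, Matrix.exp_diagonal, Matrix.smul_one_eq_diagonal, Pi.exp_def]

theorem exp_add_smul_one (A : Matrix n n 𝕜) (μ : 𝕜) :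
    NormedSpace.exp (A + μ • (1 : Matrix n n 𝕜)) = NormedSpace.exp μ • NormedSpace.exp A := by
  rw [Matrix.exp_add_of_commute _ _ ((Commute.one_right A).smul_right μ), exp_smul_one,
    mul_smul_comm, mul_one]

theorem exp_mulVec_of_sq {L : Matrix n n 𝕜} {μ : 𝕜} {v : n → 𝕜}
    (hv : (L - μ • 1) *ᵥ ((L - μ • 1) *ᵥ v) = 0) :
    NormedSpace.exp L *ᵥ v = NormedSpace.exp μ • (v + (L - μ • 1) *ᵥ v) := by
  conv_lhs => rw [← sub_add_cancel L (μ • (1 : Matrix n n 𝕜))]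
  rw [exp_add_smul_one, Matrix.smul_mulVec, exp_mulVec_of_mulVec_mulVec_eq_zero hv]

theorem exp_mulVec_of_eigenvector {L : Matrix n n 𝕜} {μ : 𝕜} {v : n → 𝕜} (hv : L *ᵥ v = μ • v) :
    NormedSpace.exp L *ᵥ v = NormedSpace.exp μ • v := by
  have h : (L - μ • (1 : Matrix n n 𝕜)) *ᵥ v = 0 := by
    rw [Matrix.sub_mulVec, hv, Matrix.smul_mulVec, Matrix.one_mulVec, sub_self]
  rw [exp_mulVec_of_sq (μ := μ) (by rw [h, Matrix.mulVec_zero]), h, add_zero]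

theorem IsLog.isUnit {L B : Matrix n n 𝕜} (hL : IsLog L B) (hB : B.charpoly.eval 1 ≠ 0) :
    IsUnit L := by
  rw [isUnit_iff_mulVec]
  intro v hv
  refine (eval_charpoly_ne_zero_iff B 1).1 hB v ?_
  rw [← (show NormedSpace.exp L = B from hL), exp_mulVec_of_eigenvector (μ := 0) (by simpa using hv),
    NormedSpace.exp_zero]

theorem IsLog.eval_charpoly_ne_zero {L B : Matrix n n 𝕜} (hL : IsLog L B) (μ : 𝕜)
    (hB : B.charpoly.eval (NormedSpace.exp μ) ≠ 0) : L.charpoly.eval μ ≠ 0 := by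
  rw [eval_charpoly_ne_zero_iff] at *
  intro v hv
  refine hB v ?_
  rw [← (show NormedSpace.exp L = B from hL), exp_mulVec_of_eigenvector hv]

end Exp

/-! ### The affine system over one time step -/

section Ode

variable {𝕜 : Type*} [RCLike 𝕜] {M : ℕ}

theorem isUnit_odeMatrix {Δt : ℝ} (hΔt : 0 < Δt) {L : Matrix (Fin M) (Fin M) 𝕜} (hL : IsUnit L) :
    IsUnit (odeMatrix Δt L) := by
  rw [isUnit_iff_mulVec] at *
  intro v hv
  rw [odeMatrix, Matrix.smul_mulVec, smul_eq_zero_iff_right (by positivity)] at hv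
  exact hL v hv

theorem eval_one_charpoly_odeMatrix_ne_zero {Δt : ℝ} (hΔt : 0 < Δt)
    {L : Matrix (Fin M) (Fin M) 𝕜} (hL : L.charpoly.eval (Δt : 𝕜) ≠ 0) :
    (odeMatrix Δt L).charpoly.eval 1 ≠ 0 := by
  rw [eval_charpoly_ne_zero_iff] at *
  intro v hv
  refine hL v ?_
  rw [odeMatrix, Matrix.smul_mulVec, one_smul, one_div, inv_smul_eq_iff₀ hΔt.ne'] at hv
  rw [hv, RCLike.real_smul_eq_coe_smul (K := 𝕜)]

/-- Around the fixed point p of the affine map the system is linear, with flow exp((t - t₀)A), and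
this flow is B after time Δt. -/
theorem reproducesStep_of_isLog {Δt : ℝ} (hΔt : 0 < Δt) {L B : Matrix (Fin M) (Fin M) 𝕜}
    (hL : IsLog L B) (hB : B.charpoly.eval 1 ≠ 0) (h : Fin M → 𝕜)
    (F : (Fin M → ℝ) → (Fin M → ℝ))
    (hF : ∀ Z : Fin M → ℝ, (fun i => (F Z i : 𝕜)) = B *ᵥ (fun i => (Z i : 𝕜)) + h) :
    ReproducesStep (odeMatrix Δt L) (odeBias Δt L B h) Δt F := by
  set A := odeMatrix Δt L with hA
  set p : Fin M → 𝕜 := (1 - B)⁻¹ *ᵥ h with hp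
  have hdet : IsUnit (1 - B).det := by
    rw [Matrix.eval_charpoly, map_one] at hB
    exact hB.isUnit
  have hfix : p = B *ᵥ p + h := by
    have : (1 - B) *ᵥ p = h := by
      rw [hp, Matrix.mulVec_mulVec, Matrix.mul_nonsing_inv _ hdet, Matrix.one_mulVec]
    rw [← this, Matrix.sub_mulVec, Matrix.one_mulVec]
    abel
  have hbias : odeBias Δt L B h = -(A *ᵥ p) := by
    rw [odeBias, hA, odeMatrix, hp, Matrix.smul_mulVec, Matrix.mulVec_mulVec]
  have hexp : NormedSpace.exp (Δt • A) = B := by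
    rw [hA, odeMatrix, smul_smul, mul_one_div_cancel hΔt.ne', one_smul]
    exact hL
  intro t₀ Z
  set z : Fin M → 𝕜 := fun i => (Z i : 𝕜) with hz
  set ξ : ℝ → Fin M → 𝕜 := fun t => NormedSpace.exp ((t - t₀) • A) *ᵥ (z - p) + p with hξ
  have hξd : ∀ t, HasDerivAt ξ (A *ᵥ ξ t + odeBias Δt L B h) t := by
    intro t
    refine ((hasDerivAt_exp_smul_mulVec A (z - p) t₀ t).add_const p).congr_deriv ?_
    rw [hbias, hξ, Matrix.mulVec_add]
    abel
  have hξ0 : ξ t₀ = z := by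
    simp [hξ]
  refine ⟨⟨ξ, fun t _ => (hξd t).hasDerivWithinAt, hξ0⟩, ?_⟩
  intro ζ hζ hζ0
  let T : (Fin M → 𝕜) →L[𝕜] (Fin M → 𝕜) := A.mulVecLin.toContinuousLinearMap
  have hlip : LipschitzWith ‖T‖₊ fun x : Fin M → 𝕜 => A *ᵥ x + odeBias Δt L B h := by
    have := T.lipschitz.add (LipschitzWith.const (odeBias Δt L B h))
    rwa [add_zero] at this
  have huniq := ODE_solution_unique (v := fun _ x => A *ᵥ x + odeBias Δt L B h)
    (fun _ => hlip) (fun t ht => (hζ t ht).continuousWithinAt)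
    (fun t ht => (hζ t (Set.Ico_subset_Icc_self ht)).mono_of_mem_nhdsWithin
      (Icc_mem_nhdsGE_of_mem ht))
    (fun t _ => (hξd t).continuousAt.continuousWithinAt)
    (fun t _ => (hξd t).hasDerivWithinAt) (hζ0.trans hξ0.symm)
  rw [huniq ⟨by linarith, le_rfl⟩, hF]
  simp only [hξ, add_sub_cancel_left, hexp, Matrix.mulVec_sub]
  nth_rw 2 [hfix]
  abel

end Ode

/-! ### Complex logarithms and diagonalizability -/

section Complex

variable {n : Type*} [Fintype n] [DecidableEq n]

theorem exists_isLog_complex (B : Matrix n n ℂ) (hB : IsUnit B) :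
    ∃ L, IsLog L B := by
  -- The imaginary part of (1 + si)μ is Im μ + s Re μ; the finitely many s that make it vanish for
  -- an eigenvalue μ with nonzero real part are avoided.
  obtain ⟨s, hs⟩ := Infinite.exists_notMem_finset
    (B.charpoly.roots.toFinset.image fun μ : ℂ => -μ.im / μ.re)
  have hs' : ∀ v, ∀ μ : ℂ, B *ᵥ v = μ • v → ((1 + s * Complex.I) * μ).im = 0 → v = 0 := by
    intro v μ hv him
    by_contra hv0
    have hroot : B.charpoly.eval μ = 0 := by
      by_contra hne
      exact hv0 ((eval_charpoly_ne_zero_iff B μ).1 hne v hv)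
    have hmem : μ ∈ B.charpoly.roots.toFinset := by
      rw [Multiset.mem_toFinset, Polynomial.mem_roots B.charpoly_monic.ne_zero]
      exact hroot
    have h1 : μ.im + s * μ.re = 0 := by simpa using him
    by_cases hre : μ.re = 0
    · have : μ = 0 := Complex.ext hre (by simpa [hre] using h1)
      rw [this, zero_smul] at hv
      exact hv0 ((isUnit_iff_mulVec B).1 hB v hv)
    · refine hs (Finset.mem_image.2 ⟨μ, hmem, ?_⟩)
      field_simp
      linarith
  set c : ℂ := 1 + s * Complex.I with hc
  have hc0 : c ≠ 0 := fun h => by simpa [hc] using congrArg Complex.re h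
  obtain ⟨L, hL, -⟩ := exists_isLog_of_segment (c • B) (by
    intro t ht
    rw [isUnit_iff_mulVec]
    intro v hv
    rcases eq_or_ne t 0 with rfl | ht0
    · simpa using hv
    · have h2 : ((t : ℂ) * c) • (B *ᵥ v) = ((t : ℂ) - 1) • v := by
        have : ((1 : Matrix n n ℂ) + t • (c • B - 1)) *ᵥ v
            = v + ((t : ℂ) * c) • (B *ᵥ v) - (t : ℂ) • v := by
          simp only [Matrix.add_mulVec, Matrix.smul_mulVec, Matrix.sub_mulVec, Matrix.one_mulVec,
            smul_sub, mul_smul]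
          simp only [Complex.coe_smul]
          abel
        rw [this] at hv
        rw [sub_smul, one_smul]
        linear_combination (exp := 1) hv
      have htc : (t : ℂ) ≠ 0 := by exact_mod_cast ht0
      -- A kernel vector on the segment is an eigenvector of cB to the real number (t - 1)/t, which
      -- the choice of s excludes.
      refine hs' v (((t : ℂ) * c)⁻¹ * ((t : ℂ) - 1)) ?_ ?_
      · rw [mul_smul, ← h2, smul_smul, inv_mul_cancel₀ (mul_ne_zero htc hc0), one_smul]
      · have : c * (((t : ℂ) * c)⁻¹ * ((t : ℂ) - 1)) = (((t⁻¹ * (t - 1)) : ℝ) : ℂ) := by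
          push_cast
          field_simp
        rw [this, Complex.ofReal_im])
  refine ⟨L + (-Complex.log c) • 1, ?_⟩
  rw [IsLog, exp_add_smul_one, show NormedSpace.exp L = c • B from hL, ← Complex.exp_eq_exp_ℂ,
    Complex.exp_neg, Complex.exp_log hc0, smul_smul, inv_mul_cancel₀ hc0, one_smul]

/-- Adding 2πik to a logarithm translates its finite spectrum, so some integer k moves it off μ. -/
theorem exists_isLog_complex_eval_charpoly_ne_zero (B : Matrix n n ℂ) (hB : IsUnit B) (μ : ℂ) :
    ∃ L, IsLog L B ∧ L.charpoly.eval μ ≠ 0 := by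
  obtain ⟨L, hL⟩ := exists_isLog_complex B hB
  have hinj : Function.Injective fun k : ℤ => μ - k * (2 * Real.pi * Complex.I) := by
    intro j k hjk
    have := mul_right_cancel₀ Complex.two_pi_I_ne_zero (sub_right_injective hjk)
    exact_mod_cast this
  obtain ⟨k, hk⟩ := Infinite.exists_notMem_finset
    (L.charpoly.roots.toFinset.preimage _ hinj.injOn)
  refine ⟨L + (k * (2 * Real.pi * Complex.I) : ℂ) • 1, ?_, ?_⟩
  · rw [IsLog, exp_add_smul_one, ← Complex.exp_eq_exp_ℂ, Complex.exp_int_mul_two_pi_mul_I, one_smul]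
    exact hL
  · rw [Finset.mem_preimage, Multiset.mem_toFinset,
      Polynomial.mem_roots L.charpoly_monic.ne_zero] at hk
    have hk' := (eval_charpoly_ne_zero_iff L _).1 hk
    rw [eval_charpoly_ne_zero_iff]
    intro v hv
    refine hk' v ?_
    rw [Matrix.add_mulVec, Matrix.smul_mulVec, Matrix.one_mulVec] at hv
    rw [sub_smul, ← hv, add_sub_cancel_right]

/-- Without Jordan chains of length two, every generalized eigenvector is an eigenvector, so
eigenvectors span and contain a basis. -/
theorem isDiagonalizable_of_sq (L : Matrix n n ℂ)
    (hL : ∀ μ : ℂ, ∀ v, (L - μ • 1) *ᵥ ((L - μ • 1) *ᵥ v) = 0 → (L - μ • 1) *ᵥ v = 0) :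
    IsDiagonalizable L := by
  set S : Set (n → ℂ) := {v | ∃ μ : ℂ, L *ᵥ v = μ • v} with hS
  have hspan : ⊤ ≤ Submodule.span ℂ S := by
    rw [← Module.End.iSup_maxGenEigenspace_eq_top (K := ℂ) L.mulVecLin]
    refine iSup_le fun μ v hv => Submodule.subset_span ⟨μ, ?_⟩
    obtain ⟨k, hk⟩ := Module.End.mem_maxGenEigenspace _ _ _ |>.1 hv
    have key : ∀ k : ℕ, ∀ v, ((L.mulVecLin - μ • (1 : Module.End ℂ (n → ℂ))) ^ k) v = 0 →
        (L - μ • 1) *ᵥ v = 0 := by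
      intro k
      induction k with
      | zero =>
        intro v hv
        simp only [pow_zero, Module.End.one_apply] at hv
        rw [hv, Matrix.mulVec_zero]
      | succ k ih =>
        intro v hv
        rw [pow_succ, Module.End.mul_apply] at hv
        refine hL μ v ?_
        convert ih _ hv using 2
        simp [Matrix.sub_mulVec, Matrix.smul_mulVec]
    have := key k v hk
    rwa [Matrix.sub_mulVec, Matrix.smul_mulVec, Matrix.one_mulVec, sub_eq_zero] at this
  let b := Module.Basis.ofSpan hspan
  have hb : ∀ i, ∃ μ : ℂ, L *ᵥ b i = μ • b i := fun i =>
    Module.Basis.ofSpan_subset hspan ⟨i, rfl⟩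
  let : Fintype _ := FiniteDimensional.fintypeBasisIndex b
  have hcard := (Module.finrank_eq_card_basis b).symm.trans (Module.finrank_fintype_fun_eq_card ℂ)
  let e := b.reindex (Fintype.equivOfCardEq hcard)
  have he : ∀ i : n, ∃ μ : ℂ, L *ᵥ e i = μ • e i := fun i => by
    simpa [e] using hb _
  choose d hd using he
  set P : Matrix n n ℂ := Matrix.of fun i j => e j i with hP
  have hcol : ∀ j, P.col j = e j := fun j => rfl
  have hPu : IsUnit P := by
    rw [← Matrix.linearIndependent_cols_iff_isUnit]
    exact e.linearIndependent
  have hLP : L * P = P * diagonal d := by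
    ext i j
    have := congrFun (hd j) i
    simp only [Matrix.mul_diagonal]
    rw [mul_comm]
    exact this
  refine ⟨P, d, hPu, ?_⟩
  rw [← hLP, Matrix.mul_nonsing_inv_cancel_right _ _ ((Matrix.isUnit_iff_isUnit_det _).1 hPu)]

theorem IsDiagonalizable.mulVec_eq_zero {B : Matrix n n ℂ} (hB : IsDiagonalizable B) (c : ℂ)
    (v : n → ℂ) (hv : (B - c • 1) *ᵥ ((B - c • 1) *ᵥ v) = 0) : (B - c • 1) *ᵥ v = 0 := by
  obtain ⟨P, d, hP, rfl⟩ := hB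
  have hdet := (Matrix.isUnit_iff_isUnit_det _).1 hP
  have hPP : P * P⁻¹ = 1 := Matrix.mul_nonsing_inv _ hdet
  have hPP' : P⁻¹ * P = 1 := Matrix.nonsing_inv_mul _ hdet
  have hform : P * diagonal d * P⁻¹ - c • 1 = P * diagonal (fun i => d i - c) * P⁻¹ := by
    have : diagonal (fun i => d i - c) = diagonal d - c • (1 : Matrix n n ℂ) := by
      rw [Matrix.smul_one_eq_diagonal, ← Matrix.diagonal_sub]
    rw [this, Matrix.mul_sub, Matrix.sub_mul, mul_smul_comm, mul_one, smul_mul_assoc, hPP]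
  rw [hform] at hv ⊢
  set w := P⁻¹ *ᵥ v with hw
  have h1 : diagonal (fun i => d i - c) *ᵥ (diagonal (fun i => d i - c) *ᵥ w) = 0 := by
    have := congrArg (P⁻¹ *ᵥ ·) hv
    simp only [Matrix.mulVec_zero, Matrix.mulVec_mulVec] at this
    rw [hw, Matrix.mulVec_mulVec, Matrix.mulVec_mulVec, ← this]
    congr 1
    simp only [← mul_assoc, hPP', one_mul]
    simp only [mul_assoc, hPP', one_mul]
  have h2 : diagonal (fun i => d i - c) *ᵥ w = 0 := by
    ext i
    have := congrFun h1 i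
    simp only [Matrix.mulVec_diagonal, Pi.zero_apply, mul_eq_zero] at this ⊢
    tauto
  rw [← Matrix.mulVec_mulVec, ← Matrix.mulVec_mulVec, ← hw, h2, Matrix.mulVec_zero]

/-- On vectors killed by (L - μ)², the matrix B - exp μ acts as exp μ · (L - μ), so a chain of
length two for L would be one for B. -/
theorem IsLog.isDiagonalizable {L B : Matrix n n ℂ} (hL : IsLog L B) (hB : IsDiagonalizable B) :
    IsDiagonalizable L := by
  refine isDiagonalizable_of_sq L fun μ v hv => ?_
  set N := L - μ • (1 : Matrix n n ℂ) with hN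
  have hexp : NormedSpace.exp μ ≠ (0 : ℂ) := by
    rw [← Complex.exp_eq_exp_ℂ]
    exact Complex.exp_ne_zero μ
  have h1 : ∀ w, N *ᵥ (N *ᵥ w) = 0 →
      (B - NormedSpace.exp μ • (1 : Matrix n n ℂ)) *ᵥ w = NormedSpace.exp μ • (N *ᵥ w) := by
    intro w hw
    rw [← (show NormedSpace.exp L = B from hL), Matrix.sub_mulVec, exp_mulVec_of_sq hw,
      Matrix.smul_mulVec, Matrix.one_mulVec, smul_add, add_sub_cancel_left]
  have h2 := hB.mulVec_eq_zero (NormedSpace.exp μ) v (by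
    rw [h1 v hv, Matrix.mulVec_smul, h1 _ (by rw [hv, Matrix.mulVec_zero]), hv, smul_zero,
      smul_zero])
  rw [h1 v hv] at h2
  exact (smul_eq_zero_iff_right hexp).1 h2

theorem IsDiagonalizable.smul {L : Matrix n n ℂ} (hL : IsDiagonalizable L) (c : ℝ) :
    IsDiagonalizable (c • L) := by
  obtain ⟨P, d, hP, h⟩ := hL
  refine ⟨P, c • d, hP, ?_⟩
  rw [Matrix.diagonal_smul, mul_smul_comm, smul_mul_assoc, ← h]

end Complex

end PLRNN

namespace PLRNN

/-! ### Exponentials of transported matrices and of complex structures -/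

section ExpReal

variable {n m : Type*} [Fintype n] [DecidableEq n] [Fintype m] [DecidableEq m]

theorem mul_mul_pow_succ {P : Matrix n m ℝ} {Q : Matrix m n ℝ} (hQP : Q * P = 1)
    (X : Matrix m m ℝ) (k : ℕ) : (P * X * Q) ^ (k + 1) = P * X ^ (k + 1) * Q := by
  induction k with
  | zero => simp
  | succ k ih =>
    rw [pow_succ, ih]
    calc P * X ^ (k + 1) * Q * (P * X * Q) = P * X ^ (k + 1) * (Q * P) * X * Q := by
          simp only [Matrix.mul_assoc]
      _ = P * X ^ (k + 1 + 1) * Q := by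
          rw [hQP, Matrix.mul_one, pow_succ X (k + 1), Matrix.mul_assoc P]

/-- The two exponential series correspond term by term except at k = 0, where 1 stands against P *
Q. -/
theorem exp_mul_mul {P : Matrix n m ℝ} {Q : Matrix m n ℝ} (hQP : Q * P = 1) (X : Matrix m m ℝ) :
    NormedSpace.exp (P * X * Q) = 1 - P * Q + P * NormedSpace.exp X * Q := by
  have h1 := (hasSum_exp X).map
    (AddMonoidHom.mk' (fun Y => P * Y * Q) (fun Y Z => by rw [Matrix.mul_add, Matrix.add_mul]) :
      Matrix m m ℝ →+ Matrix n n ℝ)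
    (by
      change Continuous fun Y : Matrix m m ℝ => P * Y * Q
      fun_prop)
  have h2 := (hasSum_exp (P * X * Q)).sub h1
  have h3 := hasSum_single (L := SummationFilter.unconditional ℕ)
    (f := fun k : ℕ => (k.factorial : ℝ)⁻¹ • (P * X * Q) ^ k -
      P * ((k.factorial : ℝ)⁻¹ • X ^ k) * Q) 0 (by
      intro k hk
      obtain ⟨j, rfl⟩ := Nat.exists_eq_succ_of_ne_zero hk
      rw [Nat.succ_eq_add_one, mul_mul_pow_succ hQP, Matrix.mul_smul, Matrix.smul_mul, sub_self])
  have h4 := h2.unique h3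
  simp only [Nat.factorial_zero, Nat.cast_one, inv_one, pow_zero, one_smul, Matrix.mul_one] at h4
  rw [← h4]
  exact (sub_add_cancel _ _).symm

open scoped Matrix.Norms.Operator in
-- The image of Euler's identity under the algebra map from ℂ that sends i to R.
theorem exp_pi_smul_of_mul_self {R : Matrix m m ℝ} (hR : R * R = -1) :
    NormedSpace.exp (Real.pi • R) = -1 := by
  let φ : ℂ →ₐ[ℝ] Matrix m m ℝ := Complex.liftAux R hR
  have hφ : Continuous φ := φ.toLinearMap.continuous_of_finiteDimensional
  let : NormedAlgebra ℚ (Matrix m m ℝ) := NormedAlgebra.restrictScalars ℚ ℝ _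
  have h := NormedSpace.map_exp φ hφ (Real.pi * Complex.I)
  rw [← Complex.exp_eq_exp_ℂ, Complex.exp_pi_mul_I, map_neg, map_one, ← Complex.real_smul,
    map_smul, Complex.liftAux_apply_I] at h
  exact h.symm

end ExpReal

/-! ### Real and imaginary parts, and singular members of a pencil -/

section RealPart

variable {l m n : Type*} [Fintype m]

theorem map_re_toComplex_mul (A : Matrix l m ℝ) (X : Matrix m n ℂ) :
    (toComplex A * X).map Complex.re = A * X.map Complex.re := by
  ext i j
  simp [toComplex, Matrix.mul_apply]

theorem map_im_toComplex_mul (A : Matrix l m ℝ) (X : Matrix m n ℂ) :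
    (toComplex A * X).map Complex.im = A * X.map Complex.im := by
  ext i j
  simp [toComplex, Matrix.mul_apply]

theorem map_re_mul_toComplex (X : Matrix l m ℂ) (A : Matrix m n ℝ) :
    (X * toComplex A).map Complex.re = X.map Complex.re * A := by
  ext i j
  simp [toComplex, Matrix.mul_apply]

theorem map_im_mul_toComplex (X : Matrix l m ℂ) (A : Matrix m n ℝ) :
    (X * toComplex A).map Complex.im = X.map Complex.im * A := by
  ext i j
  simp [toComplex, Matrix.mul_apply]

theorem toComplex_mul (A : Matrix l m ℝ) (X : Matrix m n ℝ) :
    toComplex (A * X) = toComplex A * toComplex X := by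
  ext i j
  simp [toComplex, Matrix.mul_apply]

theorem toComplex_mulVec (A : Matrix l m ℝ) (v : m → ℝ) :
    vecToComplex (A *ᵥ v) = toComplex A *ᵥ vecToComplex v := by
  ext i
  simp [toComplex, vecToComplex, Matrix.mulVec, dotProduct]

theorem toComplex_re_add_I_smul_im (X : Matrix l n ℂ) :
    toComplex (X.map Complex.re) + Complex.I • toComplex (X.map Complex.im) = X := by
  ext i j
  simp only [toComplex, Matrix.add_apply, Matrix.smul_apply, Matrix.map_apply, smul_eq_mul]
  rw [mul_comm, Complex.re_add_im]

theorem toComplex_add_smul (X Y : Matrix l n ℝ) (t : ℝ) :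
    toComplex (X + t • Y) = toComplex X + (t : ℂ) • toComplex Y := by
  ext i j
  simp [toComplex]

theorem det_toComplex [DecidableEq m] (A : Matrix m m ℝ) : (toComplex A).det = (A.det : ℂ) :=
  (RingHom.map_det Complex.ofRealHom A).symm

theorem eval_charpoly_toComplex [DecidableEq m] (A : Matrix m m ℝ) (x : ℝ) :
    (toComplex A).charpoly.eval (x : ℂ) = ((A.charpoly.eval x : ℝ) : ℂ) := by
  have : (toComplex A).charpoly = A.charpoly.map Complex.ofRealHom :=
    Matrix.charpoly_map A Complex.ofRealHom
  rw [this]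
  exact Polynomial.eval_map_apply Complex.ofRealHom x

theorem toComplex_isUnit [DecidableEq m] {A : Matrix m m ℝ} (hA : IsUnit A) :
    IsUnit (toComplex A) :=
  hA.map Complex.ofRealHom.mapMatrix

/-- A pencil of square matrices that is nonsingular at `i` is singular at only finitely many real
parameters. -/
theorem finite_setOf_det_add_smul_eq_zero [DecidableEq m] (U V : Matrix m m ℂ)
    (h : (U + Complex.I • V).det ≠ 0) : {t : ℝ | (U + (t : ℂ) • V).det = 0}.Finite := by
  set p : Polynomial ℂ := (U.map Polynomial.C + (Polynomial.X : Polynomial ℂ) • V.map Polynomial.C).det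
    with hp
  have hev : ∀ z : ℂ, p.eval z = (U + z • V).det := by
    intro z
    rw [hp, ← Polynomial.coe_evalRingHom, RingHom.map_det]
    congr 1
    ext i j
    simp
    exact mul_comm _ _
  have hp0 : p ≠ 0 := fun h0 => h (by rw [← hev, h0, Polynomial.eval_zero])
  refine ((p.roots.toFinset.finite_toSet).preimage Complex.ofReal_injective.injOn).subset ?_
  intro t ht
  simp only [Set.mem_preimage, Finset.mem_coe, Multiset.mem_toFinset, Polynomial.mem_roots hp0,
    Polynomial.IsRoot.def, hev]
  exact ht

end RealPart

/-! ### Real logarithms -/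

section RealLog

variable {n m : Type*} [Fintype n] [DecidableEq n] [Fintype m] [DecidableEq m]

theorem exists_isLog_real_of_no_nonpos_eigenvalue (B : Matrix n n ℝ)
    (hB : ∀ x : ℝ, x ≤ 0 → ∀ v, B *ᵥ v = x • v → v = 0) :
    ∃ L : Matrix n n ℝ, IsLog L B ∧ ∀ X, Commute X B → Commute X L := by
  refine exists_isLog_of_segment B fun t ht => ?_
  rw [isUnit_iff_mulVec]
  intro v hv
  have h1 : t • (B *ᵥ v) = (t - 1) • v := by
    simp only [Matrix.add_mulVec, Matrix.smul_mulVec, Matrix.sub_mulVec, Matrix.one_mulVec,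
      smul_sub] at hv
    rw [sub_smul, one_smul]
    linear_combination (exp := 1) hv
  rcases eq_or_ne t 0 with rfl | ht0
  · simpa using h1
  · refine hB (t⁻¹ * (t - 1)) ?_ v ?_
    · exact mul_nonpos_of_nonneg_of_nonpos (inv_nonneg.2 ht.1) (by linarith [ht.2])
    · rw [mul_smul, ← h1, smul_smul, inv_mul_cancel₀ ht0, one_smul]

/-- Suppose that over `ℂ` the eigenvectors of `B` to negative eigenvalues lie in the image of a
direct summand on which `B` acts as the real matrix `C`, that `C` has no positive eigenvalue and
commutes with a complex structure `R`. Then `B` has a real logarithm. -/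
theorem exists_isLog_real_of_intertwiner {B : Matrix n n ℝ} {C R : Matrix m m ℝ} (hB : IsUnit B)
    (hR : R * R = -1) (hRC : R * C = C * R) {P : Matrix n m ℂ} {Q : Matrix m n ℂ}
    (hP : toComplex B * P = P * toComplex C) (hQ : Q * toComplex B = toComplex C * Q)
    (hQP : Q * P = 1)
    (hBneg : ∀ x : ℝ, x < 0 → ∀ v, toComplex B *ᵥ v = (x : ℂ) • v → ∃ w, v = P *ᵥ w)
    (hCpos : ∀ y : ℝ, 0 < y → ∀ w, C *ᵥ w = y • w → w = 0) :
    ∃ L : Matrix n n ℝ, IsLog L B := by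
  -- At parameter i the pencil is Q * P = 1, so all but finitely many real t work. Real and
  -- imaginary parts of P both intertwine B and C, hence so does S.
  obtain ⟨t, ht⟩ : ∃ t : ℝ, (Q * toComplex (P.map Complex.re + t • P.map Complex.im)).det ≠ 0 := by
    have hfin := finite_setOf_det_add_smul_eq_zero (Q * toComplex (P.map Complex.re))
      (Q * toComplex (P.map Complex.im)) (by
        rw [← Matrix.mul_smul, ← Matrix.mul_add, toComplex_re_add_I_smul_im, hQP, Matrix.det_one]
        exact one_ne_zero)
    obtain ⟨t, ht⟩ := hfin.exists_notMem
    refine ⟨t, ?_⟩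
    rwa [toComplex_add_smul, Matrix.mul_add, Matrix.mul_smul]
  set S : Matrix n m ℝ := P.map Complex.re + t • P.map Complex.im with hS
  have hBS : B * S = S * C := by
    rw [hS, Matrix.mul_add, Matrix.add_mul, Matrix.mul_smul, Matrix.smul_mul,
      ← map_re_toComplex_mul, ← map_im_toComplex_mul, hP, map_re_mul_toComplex,
      map_im_mul_toComplex]
  -- The first condition makes T * S invertible; the second makes T injective on the image of P,
  -- which later rules out negative eigenvectors.
  obtain ⟨s, hs1, hs2⟩ : ∃ s : ℝ,
      (toComplex (Q.map Complex.re + s • Q.map Complex.im) * toComplex S).det ≠ 0 ∧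
      (toComplex (Q.map Complex.re + s • Q.map Complex.im) * P).det ≠ 0 := by
    have hfin : ∀ X : Matrix n m ℂ, (Q * X).det ≠ 0 → {s : ℝ |
        (toComplex (Q.map Complex.re + s • Q.map Complex.im) * X).det = 0}.Finite := by
      intro X hX
      have := finite_setOf_det_add_smul_eq_zero (toComplex (Q.map Complex.re) * X)
        (toComplex (Q.map Complex.im) * X) (by
          rwa [← Matrix.smul_mul, ← Matrix.add_mul, toComplex_re_add_I_smul_im])
      simpa only [toComplex_add_smul, Matrix.add_mul, Matrix.smul_mul] using this
    obtain ⟨s, hs⟩ := ((hfin _ ht).union (hfin P (by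
      rw [hQP, Matrix.det_one]
      exact one_ne_zero))).exists_notMem
    exact ⟨s, fun h => hs (Or.inl h), fun h => hs (Or.inr h)⟩
  set T : Matrix m n ℝ := Q.map Complex.re + s • Q.map Complex.im with hT
  have hTB : T * B = C * T := by
    rw [hT, Matrix.mul_add, Matrix.add_mul, Matrix.mul_smul, Matrix.smul_mul,
      ← map_re_toComplex_mul, ← map_im_toComplex_mul, ← hQ, map_re_mul_toComplex,
      map_im_mul_toComplex]
  have hG : IsUnit (T * S).det := by
    rw [← toComplex_mul, det_toComplex, Ne, Complex.ofReal_eq_zero] at hs1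
    exact (Ne.isUnit hs1)
  have hGC : T * S * C = C * (T * S) := by
    rw [Matrix.mul_assoc, ← hBS, ← Matrix.mul_assoc, hTB, Matrix.mul_assoc]
  have hGC' : (T * S)⁻¹ * C = C * (T * S)⁻¹ := by
    calc (T * S)⁻¹ * C = (T * S)⁻¹ * (C * (T * S)) * (T * S)⁻¹ := by
          rw [Matrix.mul_assoc _ (C * _), Matrix.mul_nonsing_inv_cancel_right _ _ hG]
      _ = C * (T * S)⁻¹ := by
          rw [← hGC, Matrix.nonsing_inv_mul_cancel_left _ _ hG]
  obtain ⟨N, hN⟩ : ∃ N : Matrix m n ℝ, N = (T * S)⁻¹ * T := ⟨_, rfl⟩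
  have hNS : N * S = 1 := by
    rw [hN, Matrix.mul_assoc, Matrix.nonsing_inv_mul _ hG]
  have hNB : N * B = C * N := by
    rw [hN, Matrix.mul_assoc, hTB, ← Matrix.mul_assoc, hGC', Matrix.mul_assoc]
  have hTN : T = T * S * N := by
    rw [hN, Matrix.mul_nonsing_inv_cancel_left _ _ hG]
  have conj_mul : ∀ X Y : Matrix m m ℝ, (S * X * N) * (S * Y * N) = S * (X * Y) * N := by
    intro X Y
    calc (S * X * N) * (S * Y * N) = S * X * (N * S) * Y * N := by simp only [Matrix.mul_assoc]
      _ = S * (X * Y) * N := by rw [hNS, Matrix.mul_one, Matrix.mul_assoc S]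
  have hSN : S * (1 : Matrix m m ℝ) * N = S * N := by rw [Matrix.mul_one]
  -- A real projection commuting with B; on its image B acts as C, so the involution 1 - 2E flips
  -- the sign of B there.
  obtain ⟨E, hE⟩ : ∃ E : Matrix n n ℝ, E = S * N := ⟨_, rfl⟩
  have hEE : E * E = E := by
    rw [hE, ← hSN, conj_mul, Matrix.mul_one]
  have hBE : B * E = E * B := by
    rw [hE]
    calc B * (S * N) = S * (C * N) := by rw [← Matrix.mul_assoc, hBS, Matrix.mul_assoc]
      _ = S * N * B := by rw [← hNB, Matrix.mul_assoc]
  have hinvol : (1 - 2 • E) * (1 - 2 • E) = 1 := by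
    have : (1 - 2 • E) * (1 - 2 • E) = 1 - 4 • E + 4 • (E * E) := by noncomm_ring
    rw [this, hEE, sub_add_cancel]
  have hNE : N * E = N := by rw [hE, ← Matrix.mul_assoc, hNS, Matrix.one_mul]
  obtain ⟨K, hK, hKcomm⟩ := exists_isLog_real_of_no_nonpos_eigenvalue (B * (1 - 2 • E)) (by
    intro x hx v hv
    rcases hx.eq_or_lt with rfl | hx
    · refine (isUnit_iff_mulVec _).1 (hB.mul (IsUnit.of_mul_eq_one _ hinvol)) v ?_
      rw [hv, zero_smul]
    · have h1 : N * (B * (1 - 2 • E)) = -(C * N) := by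
        rw [← Matrix.mul_assoc, hNB, Matrix.mul_sub, Matrix.mul_one, Matrix.mul_smul,
          Matrix.mul_assoc, hNE, two_smul]
        abel
      have h2 : C *ᵥ (N *ᵥ v) = (-x) • (N *ᵥ v) := by
        rw [neg_smul, ← Matrix.mulVec_smul, ← hv, Matrix.mulVec_mulVec, Matrix.mulVec_mulVec, h1,
          Matrix.neg_mulVec, neg_neg]
      -- Since N v = 0, v is an eigenvector of B itself to x < 0, hence v = P w; then T v = 0 forces
      -- w = 0.
      have h3 := hCpos (-x) (by linarith) _ h2
      have h4 : E *ᵥ v = 0 := by rw [hE, ← Matrix.mulVec_mulVec, h3, Matrix.mulVec_zero]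
      have h5 : B *ᵥ v = x • v := by
        rwa [← Matrix.mulVec_mulVec, Matrix.sub_mulVec, Matrix.smul_mulVec, h4, smul_zero,
          sub_zero, Matrix.one_mulVec] at hv
      obtain ⟨w, hw⟩ := hBneg x hx (vecToComplex v) (by
        rw [← toComplex_mulVec, h5]
        ext i
        simp [vecToComplex])
      have h6 : T *ᵥ v = 0 := by rw [hTN, ← Matrix.mulVec_mulVec, h3, Matrix.mulVec_zero]
      have h7 : (toComplex T * P) *ᵥ w = 0 := by
        rw [← Matrix.mulVec_mulVec, ← hw, ← toComplex_mulVec, h6]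
        ext i
        simp [vecToComplex]
      have h8 : w = 0 := Matrix.eq_zero_of_mulVec_eq_zero hs2 h7
      rw [h8, Matrix.mulVec_zero] at hw
      ext i
      simpa [vecToComplex] using congrFun hw i)
  -- The second summand exponentiates to the involution 1 - 2E, which undoes the sign flip; it
  -- commutes with K because K lies in the bicommutant.
  refine ⟨K + S * (Real.pi • R) * N, ?_⟩
  have hexp : NormedSpace.exp (S * (Real.pi • R) * N) = 1 - 2 • E := by
    rw [exp_mul_mul hNS, exp_pi_smul_of_mul_self hR, Matrix.mul_neg, Matrix.mul_one,
      Matrix.neg_mul, two_smul, hE]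
    abel
  have hcomm : Commute (S * R * N) (B * (1 - 2 • E)) := by
    have h1 : Commute (S * R * N) B := by
      rw [Commute, SemiconjBy, Matrix.mul_assoc, hNB, ← Matrix.mul_assoc, Matrix.mul_assoc S, hRC,
        ← Matrix.mul_assoc, ← hBS]
      simp only [Matrix.mul_assoc]
    have h2 : Commute (S * R * N) E := by
      rw [Commute, SemiconjBy, hE, ← hSN, conj_mul, conj_mul, Matrix.mul_one, Matrix.one_mul]
    exact h1.mul_right ((Commute.one_right _).sub_right (h2.smul_right _))
  have hcomm' : Commute (S * (Real.pi • R) * N) K := by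
    rw [Matrix.mul_smul, Matrix.smul_mul]
    exact (hKcomm _ hcomm).smul_left _
  rw [IsLog, Matrix.exp_add_of_commute _ _ hcomm'.symm, hexp, show NormedSpace.exp K = _ from hK,
    Matrix.mul_assoc, hinvol, Matrix.mul_one]

end RealLog

end PLRNN

namespace PLRNN

/-! ### Pairing the Jordan blocks -/

section Pairing

/-- If all fibres of `f` have even cardinality, then there is an involution preserving `f` and a
choice of signs that it reverses. -/
theorem exists_signed_involution {ι β : Type*} [Finite ι] (f : ι → β)
    (hf : ∀ b, Even (Nat.card {i // f i = b})) :
    ∃ (τ : ι → ι) (s : ι → ℝ), Function.Involutive τ ∧ (∀ i, f (τ i) = f i) ∧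
      (∀ i, s (τ i) = -s i) ∧ ∀ i, s i * s i = 1 := by
  choose q hq using hf
  have hcard : ∀ b, Nat.card {i // f i = b} = Nat.card (Bool × Fin (q b)) := by
    intro b
    rw [hq b]
    simp [two_mul]
  let e : ∀ b, {i // f i = b} ≃ Bool × Fin (q b) := fun b =>
    Classical.choice (Finite.card_eq.1 (hcard b))
  obtain ⟨E, hE⟩ : ∃ E : ι ≃ Σ b, Bool × Fin (q b), ∀ i, (E i).1 = f i :=
    ⟨(Equiv.sigmaFiberEquiv f).symm.trans (Equiv.sigmaCongrRight e), fun i => rfl⟩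
  let flip : (Σ b, Bool × Fin (q b)) → Σ b, Bool × Fin (q b) :=
    fun x => ⟨x.1, (!x.2.1, x.2.2)⟩
  let sign : (Σ b, Bool × Fin (q b)) → ℝ := fun x => if x.2.1 then 1 else -1
  have hflip : Function.Involutive flip := fun x => by simp [flip]
  refine ⟨fun i => E.symm (flip (E i)), fun i => sign (E i), fun i => ?_, fun i => ?_,
    fun i => ?_, fun i => ?_⟩
  · simp only [Equiv.apply_symm_apply, hflip (E i), Equiv.symm_apply_apply]
  · rw [← hE, Equiv.apply_symm_apply]
    exact hE i
  · simp only [Equiv.apply_symm_apply]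
    obtain ⟨b, c, k⟩ := E i
    cases c <;> simp [sign, flip]
  · simp only [sign]
    split_ifs <;> norm_num

end Pairing

section Jordan

theorem sigma_fin_ext {ι : Type*} {size : ι → ℕ} {x y : Σ i, Fin (size i)} (h1 : x.1 = y.1)
    (h2 : (x.2 : ℕ) = (y.2 : ℕ)) : x = y := by
  obtain ⟨i, j⟩ := x
  obtain ⟨i', j'⟩ := y
  obtain rfl : i = i' := h1
  obtain rfl : j = j' := Fin.ext h2
  rfl

theorem jordanBlock_mulVec_eq_smul {k : ℕ} {μ y : ℂ} (hy : y ≠ μ) {w : Fin k → ℂ}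
    (hw : jordanBlock k μ *ᵥ w = y • w) : w = 0 := by
  refine (eval_charpoly_ne_zero_iff (jordanBlock k μ) y).1 ?_ w hw
  rw [Matrix.eval_charpoly, Matrix.det_of_isUpperTriangular]
  · refine Finset.prod_ne_zero_iff.2 fun i _ => ?_
    simpa [jordanBlock, sub_eq_zero] using hy
  · intro i j hij
    have hij' : j < i := hij
    have h1 : i ≠ j := hij'.ne'
    have h2 : ¬ (i : ℕ) + 1 = j := by
      have : (j : ℕ) < i := hij'
      omega
    simp [jordanBlock, h1, h2]

theorem mul_blockDiagonal'_apply {R l ι : Type*} [CommRing R] [Fintype ι] [DecidableEq ι]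
    {κ : ι → Type*} [∀ i, Fintype (κ i)] (A : Matrix l (Σ i, κ i) R)
    (D : ∀ i, Matrix (κ i) (κ i) R) (a : l) (i : ι) (k : κ i) :
    (A * blockDiagonal' D) a ⟨i, k⟩ = ∑ j, A a ⟨i, j⟩ * D i j k := by
  rw [Matrix.mul_apply, Fintype.sum_sigma, Finset.sum_eq_single i]
  · simp only [Matrix.blockDiagonal'_apply_eq]
  · intro i' _ hi'
    refine Finset.sum_eq_zero fun j _ => ?_
    rw [Matrix.blockDiagonal'_apply_ne _ _ _ hi', mul_zero]
  · simp

theorem blockDiagonal'_mul_apply {R l ι : Type*} [CommRing R] [Fintype ι] [DecidableEq ι]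
    {κ : ι → Type*} [∀ i, Fintype (κ i)] (A : Matrix (Σ i, κ i) l R)
    (D : ∀ i, Matrix (κ i) (κ i) R) (a : l) (i : ι) (k : κ i) :
    (blockDiagonal' D * A) ⟨i, k⟩ a = ∑ j, D i k j * A ⟨i, j⟩ a := by
  rw [Matrix.mul_apply, Fintype.sum_sigma, Finset.sum_eq_single i]
  · simp only [Matrix.blockDiagonal'_apply_eq]
  · intro i' _ hi'
    refine Finset.sum_eq_zero fun j _ => ?_
    rw [Matrix.blockDiagonal'_apply_ne _ _ _ hi'.symm, zero_mul]
  · simp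

theorem blockDiagonal'_mulVec_apply {R ι : Type*} [CommRing R] [Fintype ι] [DecidableEq ι]
    {κ : ι → Type*} [∀ i, Fintype (κ i)] (D : ∀ i, Matrix (κ i) (κ i) R) (u : (Σ i, κ i) → R)
    (i : ι) (k : κ i) :
    (blockDiagonal' D *ᵥ u) ⟨i, k⟩ = (D i *ᵥ fun j => u ⟨i, j⟩) k := by
  have := blockDiagonal'_mul_apply (Matrix.replicateCol Unit u) D () i k
  rw [← Matrix.replicateCol_mulVec] at this
  exact this

/-- The block diagonal matrix with real Jordan blocks. -/
def realJordan {ι : Type*} [DecidableEq ι] (size : ι → ℕ) (ev : ι → ℝ) :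
    Matrix (Σ i, Fin (size i)) (Σ i, Fin (size i)) ℝ :=
  Matrix.of fun a b => if a.1 = b.1 then
    if (a.2 : ℕ) = b.2 then ev a.1 else if (a.2 : ℕ) + 1 = b.2 then 1 else 0 else 0

theorem toComplex_realJordan {ι : Type*} [DecidableEq ι] (size : ι → ℕ) (ev : ι → ℝ) :
    toComplex (realJordan size ev) = blockDiagonal' fun i => jordanBlock (size i) (ev i) := by
  ext ⟨i, j⟩ ⟨i', j'⟩
  by_cases h : i = i'
  · subst h
    rw [Matrix.blockDiagonal'_apply_eq]
    simp only [toComplex, realJordan, jordanBlock, Matrix.map_apply, Matrix.of_apply, if_true,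
      Fin.ext_iff]
    split_ifs <;> simp
  · rw [Matrix.blockDiagonal'_apply_ne _ _ _ h]
    simp [toComplex, realJordan, h]

theorem realJordan_mulVec_eq_smul {ι : Type*} [Fintype ι] [DecidableEq ι] {size : ι → ℕ}
    {ev : ι → ℝ} {y : ℝ} (hy : ∀ i, y ≠ ev i) {w : (Σ i, Fin (size i)) → ℝ}
    (hw : realJordan size ev *ᵥ w = y • w) : w = 0 := by
  have h : blockDiagonal' (fun i => jordanBlock (size i) (ev i)) *ᵥ vecToComplex w
      = (y : ℂ) • vecToComplex w := by
    rw [← toComplex_realJordan, ← toComplex_mulVec, hw]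
    ext i
    simp [vecToComplex]
  ext ⟨i, j⟩
  have := jordanBlock_mulVec_eq_smul (y := (y : ℂ)) (μ := (ev i : ℂ)) (k := size i)
    (w := fun j => vecToComplex w ⟨i, j⟩) (by exact_mod_cast hy i) (by
      ext k
      rw [← blockDiagonal'_mulVec_apply (fun i => jordanBlock (size i) (ev i)), h]
      rfl)
  have hj := congrFun this j
  simpa [vecToComplex] using hj

/-- If the Jordan blocks come in pairs, then a real Jordan matrix commutes with a complex
structure. -/
theorem exists_mul_self_eq_neg_one_commute_realJordan {ι : Type*} [Fintype ι] [DecidableEq ι]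
    (size : ι → ℕ) (ev : ι → ℝ)
    (heven : ∀ b, Even (Nat.card {i // (size i, ev i) = b})) :
    ∃ R : Matrix (Σ i, Fin (size i)) (Σ i, Fin (size i)) ℝ,
      R * R = -1 ∧ R * realJordan size ev = realJordan size ev * R := by
  obtain ⟨τ, s, hτ, hf, hs, hss⟩ := exists_signed_involution _ heven
  simp only [Prod.mk.injEq] at hf
  let σ : (Σ i, Fin (size i)) → Σ i, Fin (size i) :=
    fun a => ⟨τ a.1, Fin.cast (hf a.1).1.symm a.2⟩
  have hσ : Function.Involutive σ := fun a => sigma_fin_ext (hτ a.1) rfl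
  have hσ' : ∀ a b, b = σ a ↔ σ b = a := fun a b =>
    ⟨fun h => h ▸ hσ a, fun h => h ▸ (hσ b).symm⟩
  have hCσ : ∀ a b, realJordan size ev (σ a) (σ b) = realJordan size ev a b := by
    intro a b
    simp [realJordan, σ, hτ.injective.eq_iff, (hf a.1).2]
  -- A signed swap of paired blocks: opposite signs give R² = -1, and signs constant on each block
  -- let R commute with the Jordan matrix.
  let R : Matrix (Σ i, Fin (size i)) (Σ i, Fin (size i)) ℝ :=
    Matrix.of fun a b => if b = σ a then s a.1 else 0
  have hleft : ∀ (X : Matrix (Σ i, Fin (size i)) (Σ i, Fin (size i)) ℝ) a b,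
      (R * X) a b = s a.1 * X (σ a) b := by
    intro X a b
    simp [R, Matrix.mul_apply]
  have hright : ∀ (X : Matrix (Σ i, Fin (size i)) (Σ i, Fin (size i)) ℝ) a b,
      (X * R) a b = X a (σ b) * s (σ b).1 := by
    intro X a b
    rw [Matrix.mul_apply, Finset.sum_eq_single (σ b)]
    · simp [R, hσ b]
    · intro c _ hc
      simp [R, hσ', Ne.symm hc]
    · simp
  refine ⟨R, ?_, ?_⟩
  · ext a b
    rw [hleft, Matrix.neg_apply, Matrix.one_apply]
    have h1 : s (σ a).1 = -s a.1 := hs a.1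
    simp only [R, Matrix.of_apply, hσ a, h1, eq_comm (a := b)]
    split_ifs
    · rw [mul_neg, hss]
    · simp
  · ext a b
    rw [hleft, hright, ← hCσ a (σ b), hσ b]
    by_cases h : a.1 = (σ b).1
    · rw [h, mul_comm]
    · have h0 : realJordan size ev (σ a) b = 0 := by
        have : realJordan size ev a (σ b) = 0 := by simp [realJordan, h]
        rw [← hCσ, hσ b] at this
        exact this
      rw [h0, mul_zero, zero_mul]

/-- The columns of P and rows of Q belonging to negative blocks provide the intertwiners between B
and a real Jordan matrix. -/
theorem EvenNegativeJordanBlocks.exists_isLog_real {n : Type*} [Fintype n] [DecidableEq n]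
    {B : Matrix n n ℝ} (hB : IsUnit B) (hJ : EvenNegativeJordanBlocks (toComplex B)) :
    ∃ L : Matrix n n ℝ, IsLog L B := by
  classical
  obtain ⟨r, size, ev, ⟨-, P, Q, hPQ, hQP, hBJ⟩, heven⟩ := hJ
  set J := blockDiagonal' (fun i => jordanBlock (size i) (ev i)) with hJdef
  let I := {i : Fin r // ∃ x : ℝ, x < 0 ∧ ev i = x}
  let sz : I → ℕ := fun i => size i
  let x : I → ℝ := fun i => (ev i).re
  have hx : ∀ i : I, x i < 0 ∧ ev i = x i := by
    rintro ⟨i, y, hy, hev⟩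
    have : x ⟨i, y, hy, hev⟩ = y := by simp [x, hev]
    rw [this]
    exact ⟨hy, hev⟩
  let emb : (Σ i : I, Fin (sz i)) → Σ i, Fin (size i) := fun a => ⟨a.1, a.2⟩
  have hemb : Function.Injective emb := by
    intro a b hab
    have h1 : a.1 = b.1 := Subtype.ext (congrArg Sigma.fst hab)
    refine sigma_fin_ext h1 ?_
    exact congrArg (fun c : Σ i, Fin (size i) => (c.2 : ℕ)) hab
  have hCJ : toComplex (realJordan sz x) = blockDiagonal' fun i : I => jordanBlock (size i) (ev i) := by
    rw [toComplex_realJordan]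
    congr 1
    funext i
    rw [(hx i).2]
  obtain ⟨R, hR, hRC⟩ := exists_mul_self_eq_neg_one_commute_realJordan sz x (by
    rintro ⟨k, y⟩
    rcases lt_or_ge y 0 with hy | hy
    · convert heven y hy k using 1
      refine Nat.card_congr ⟨fun i => ⟨i.1.1, ?_⟩, fun i => ⟨⟨i.1, y, hy, i.2.2⟩, ?_⟩, ?_, ?_⟩
      · have h1 := i.2
        rw [Prod.mk.injEq] at h1
        refine ⟨h1.1, ?_⟩
        rw [(hx i.1).2, h1.2]
      · simp [sz, x, i.2.1, i.2.2]
      · intro i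
        rfl
      · intro i
        rfl
    · have : IsEmpty {i : I // (sz i, x i) = (k, y)} := by
        refine ⟨fun i => ?_⟩
        have h1 := i.2
        rw [Prod.mk.injEq] at h1
        linarith [(hx i.1).1]
      rw [Nat.card_of_isEmpty]
      exact Even.zero)
  refine exists_isLog_real_of_intertwiner hB hR hRC (P := P.submatrix id emb)
    (Q := Q.submatrix emb id) ?_ ?_ ?_ ?_ ?_
  · have hBP : toComplex B * P = P * J := by rw [hBJ, Matrix.mul_assoc, hQP, Matrix.mul_one]
    ext a ⟨i, k⟩
    have h1 := congrFun (congrFun hBP a) ⟨i, k⟩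
    rw [hJdef, mul_blockDiagonal'_apply] at h1
    rw [hCJ]
    refine Eq.trans ?_ (h1.trans ?_)
    · rfl
    · exact (mul_blockDiagonal'_apply (P.submatrix id emb)
        (fun i : I => jordanBlock (size i) (ev i)) a i k).symm
  · have hQB : Q * toComplex B = J * Q := by
      rw [hBJ, ← Matrix.mul_assoc, ← Matrix.mul_assoc, hQP, Matrix.one_mul]
    ext ⟨i, k⟩ a
    have h1 := congrFun (congrFun hQB ⟨i, k⟩) a
    rw [hJdef, blockDiagonal'_mul_apply] at h1
    rw [hCJ]
    refine Eq.trans ?_ (h1.trans ?_)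
    · rfl
    · exact (blockDiagonal'_mul_apply (Q.submatrix emb id)
        (fun i : I => jordanBlock (size i) (ev i)) a i k).symm
  · have : Q.submatrix emb id * P.submatrix id emb = (Q * P).submatrix emb emb := rfl
    rw [this, hQP, Matrix.submatrix_one _ hemb]
  · intro y hy v hv
    have hu : J *ᵥ (Q *ᵥ v) = (y : ℂ) • (Q *ᵥ v) := by
      rw [← Matrix.mulVec_smul, ← hv, hBJ, Matrix.mulVec_mulVec, Matrix.mulVec_mulVec,
        ← Matrix.mul_assoc, ← Matrix.mul_assoc, hQP, Matrix.one_mul]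
    -- In Jordan coordinates an eigenvector to y vanishes on every block whose eigenvalue is not y.
    have hzero : ∀ b, b ∉ Set.range emb → (Q *ᵥ v) b = 0 := by
      rintro ⟨i, k⟩ hb
      have hi : (y : ℂ) ≠ ev i := fun h => hb ⟨⟨⟨i, y, hy, h.symm⟩, k⟩, rfl⟩
      have := jordanBlock_mulVec_eq_smul (k := size i) hi (w := fun j => (Q *ᵥ v) ⟨i, j⟩) (by
        ext j
        rw [← blockDiagonal'_mulVec_apply (fun i => jordanBlock (size i) (ev i)), ← hJdef, hu]
        rfl)
      exact congrFun this k
    refine ⟨fun a => (Q *ᵥ v) (emb a), ?_⟩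
    calc v = P *ᵥ (Q *ᵥ v) := by rw [Matrix.mulVec_mulVec, hPQ, Matrix.one_mulVec]
      _ = _ := by
        ext a
        symm
        refine Fintype.sum_of_injective emb hemb _ _ (fun b hb => ?_) fun b => rfl
        rw [hzero b hb, mul_zero]
  · intro y hy w hw
    exact realJordan_mulVec_eq_smul (fun i => ((hx i).1.trans hy).ne') hw

end Jordan

/-! ### Complexification, the activation region, and the theorem -/

open scoped Matrix.Norms.Operator in
theorem IsLog.map_toComplex {n : Type*} [Fintype n] [DecidableEq n] {L B : Matrix n n ℝ}
    (hL : IsLog L B) : IsLog (toComplex L) (toComplex B) := by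
  let : NormedAlgebra ℚ (Matrix n n ℝ) := NormedAlgebra.restrictScalars ℚ ℝ _
  have hcont : Continuous (Complex.ofRealHom.mapMatrix : Matrix n n ℝ →+* Matrix n n ℂ) :=
    continuous_id.matrix_map Complex.continuous_ofReal
  have h := NormedSpace.map_exp (Complex.ofRealHom.mapMatrix : Matrix n n ℝ →+* Matrix n n ℂ)
    hcont L
  exact h.symm.trans (congrArg Complex.ofRealHom.mapMatrix hL)

theorem step_eqOn_region {M : ℕ} (a : Fin M → ℝ) (W : Matrix (Fin M) (Fin M) ℝ) (h : Fin M → ℝ)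
    (Ω : Fin M → Bool) :
    Set.EqOn (step a W h) (fun Z => pieceMatrix a W Ω *ᵥ Z + h) (region Ω) := by
  intro Z hZ
  simp only [step, pieceMatrix, Matrix.add_mulVec, ← Matrix.mulVec_mulVec]
  congr 3
  ext i
  have hi := hZ i
  rw [Matrix.mulVec_diagonal]
  by_cases hΩ : Ω i
  · simp only [hΩ, if_true] at hi ⊢
    rw [max_eq_left hi.le, one_mul]
  · simp only [hΩ] at hi ⊢
    rw [max_eq_right (by simpa using hi)]
    simp

end PLRNN

theorem theorem1 (M : ℕ) (a : Fin M → ℝ) (W : Matrix (Fin M) (Fin M) ℝ) (h : Fin M → ℝ)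
    (Ω : Fin M → Bool) (Δt : ℝ) (hΔt : 0 < Δt)
    (hinv : IsUnit (PLRNN.pieceMatrix a W Ω))
    (hone : (PLRNN.pieceMatrix a W Ω).charpoly.eval 1 ≠ 0) :
    -- on its sub-region, the network is the affine piece `Z ↦ W_Ω Z + h`
    Set.EqOn (PLRNN.step a W h) (fun Z => PLRNN.pieceMatrix a W Ω *ᵥ Z + h) (PLRNN.region Ω) ∧
    -- a logarithm exists, and it can be chosen such that `W̃` does not have the eigenvalue `1`
    (∃ L : Matrix (Fin M) (Fin M) ℂ,
      PLRNN.IsLog L (PLRNN.toComplex (PLRNN.pieceMatrix a W Ω)) ∧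
        (PLRNN.odeMatrix Δt L).charpoly.eval 1 ≠ 0) ∧
    -- every logarithm gives an equivalent continuous-time system with invertible matrix
    (∀ L : Matrix (Fin M) (Fin M) ℂ,
      PLRNN.IsLog L (PLRNN.toComplex (PLRNN.pieceMatrix a W Ω)) →
        IsUnit (PLRNN.odeMatrix Δt L) ∧
        PLRNN.ReproducesStep (PLRNN.odeMatrix Δt L)
          (PLRNN.odeBias Δt L (PLRNN.toComplex (PLRNN.pieceMatrix a W Ω))
            (PLRNN.vecToComplex h))
          Δt (fun Z => PLRNN.pieceMatrix a W Ω *ᵥ Z + h) ∧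
        ((PLRNN.pieceMatrix a W Ω).charpoly.eval (Real.exp Δt) ≠ 0 →
          (PLRNN.odeMatrix Δt L).charpoly.eval 1 ≠ 0) ∧
        (PLRNN.IsDiagonalizable (PLRNN.toComplex (PLRNN.pieceMatrix a W Ω)) →
          PLRNN.IsDiagonalizable (PLRNN.odeMatrix Δt L))) ∧
    -- the real case
    (PLRNN.EvenNegativeJordanBlocks (PLRNN.toComplex (PLRNN.pieceMatrix a W Ω)) →
      ∃ L : Matrix (Fin M) (Fin M) ℝ,
        PLRNN.IsLog L (PLRNN.pieceMatrix a W Ω) ∧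
        PLRNN.IsLog (PLRNN.toComplex L) (PLRNN.toComplex (PLRNN.pieceMatrix a W Ω)) ∧
        IsUnit (PLRNN.odeMatrix Δt L) ∧
        PLRNN.ReproducesStep (PLRNN.odeMatrix Δt L)
          (PLRNN.odeBias Δt L (PLRNN.pieceMatrix a W Ω) h)
          Δt (fun Z => PLRNN.pieceMatrix a W Ω *ᵥ Z + h)) := by
  have hone' : (PLRNN.toComplex (PLRNN.pieceMatrix a W Ω)).charpoly.eval 1 ≠ 0 := by
    have := PLRNN.eval_charpoly_toComplex (PLRNN.pieceMatrix a W Ω) 1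
    rw [Complex.ofReal_one] at this
    rw [this]
    exact_mod_cast hone
  refine ⟨PLRNN.step_eqOn_region a W h Ω, ?_, ?_, ?_⟩
  -- The value to avoid is Δt, since L/Δt has the eigenvalue 1 exactly when L has the eigenvalue Δt.
  · obtain ⟨L, hL, hL'⟩ := PLRNN.exists_isLog_complex_eval_charpoly_ne_zero _
      (PLRNN.toComplex_isUnit hinv) (Δt : ℂ)
    exact ⟨L, hL, PLRNN.eval_one_charpoly_odeMatrix_ne_zero hΔt hL'⟩
  · intro L hL
    refine ⟨PLRNN.isUnit_odeMatrix hΔt (hL.isUnit hone'),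
      PLRNN.reproducesStep_of_isLog hΔt hL hone' _ _ fun Z => ?_, fun hexp => ?_,
      fun hdiag => (hL.isDiagonalizable hdiag).smul _⟩
    · have := PLRNN.toComplex_mulVec (PLRNN.pieceMatrix a W Ω) Z
      change _ = PLRNN.toComplex (PLRNN.pieceMatrix a W Ω) *ᵥ PLRNN.vecToComplex Z + _
      rw [← this]
      ext i
      simp [PLRNN.vecToComplex]
    · refine PLRNN.eval_one_charpoly_odeMatrix_ne_zero hΔt (hL.eval_charpoly_ne_zero _ ?_)
      rw [← Complex.exp_eq_exp_ℂ]
      change Polynomial.eval (Complex.exp (Δt : ℂ)) _ ≠ 0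
      rw [← Complex.ofReal_exp, PLRNN.eval_charpoly_toComplex]
      exact_mod_cast hexp
  · intro hJ
    obtain ⟨L, hL⟩ := hJ.exists_isLog_real hinv
    refine ⟨L, hL, ?_, PLRNN.isUnit_odeMatrix hΔt (hL.isUnit hone),
      PLRNN.reproducesStep_of_isLog hΔt hL hone _ _ fun Z => rfl⟩
    exact PLRNN.IsLog.map_toComplex hL
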